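/- **Theorem 3.** A *planar 4-valent graph* is a nonempty compact subset of the plane which near each of its points is either an arc or a 4-valent vertex (two arcs crossing in one point); closed curves without vertices and disconnected graphs are allowed, and graphs are considered up to planar isotopy. The *unknot* is a single circle without vertices. Let $K$ be a field and let $A,B,a\in K$ with $A\neq B$ and $a\neq 0$ (for instance the field of rational functions in three variables $A,B,a$). Put $$\mu=\frac{a-a^{-1}}{A-B}+1,\qquad \mathcal O=\frac{Aa^{-1}-Ba}{A-B}-(A+B),\qquad \gamma=\frac{B^2a-A^2a^{-1}}{A-B}+AB,\qquad \xi=\frac{B^3a-A^3a^{-1}}{A-B}.$$ Then there is at most one function $[\,\cdot\,]$ from planar 4-valent graphs to $K$ which takes the value $1$ on the unknot and satisfies the following four identities (the graphical calculus), each for all families of graphs that agree outside a disc and inside it are the indicated pictures. 1. $[C]=\mu\,[I]$, where $I$ is a single arc and $C$ is this arc together with a small circle beside it. 2. $[L]=\mathcal O\,[I]$, where $L$ is an arc that crosses itself in one vertex and so forms an empty loop. 3. $[D]=(1-AB)[E]+\gamma[E']-(A+B)[X]$, where $D$ consists of two vertices joined by two edges bounding an empty bigon, one vertex carrying the ends $1,2$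 and the other the ends $3,4$ (ends numbered in cyclic order); $E$ consists of two disjoint arcs $23$, $41$; $E'$ of two disjoint arcs $12$, $34$; and $X$ is a single vertex. 4. With six ends numbered $1,\dots,6$ in cyclic order, $$[T']-[T]=AB\bigl([V_{23}]-[V_{12}]+[V_{45}]-[V_{34}]+[V_{61}]-[V_{56}]\bigr)+\xi\bigl([J]-[J']\bigr).$$ Here $T$ and $T'$ consist of three arcs $14,25,36$ crossing pairwise in three vertices around an empty triangle; in $T$ the three vertices carry the pairs of ends $\{1,2\},\{3,4\},\{5,6\}$, in $T'$ the pairs $\{2,3\},\{4,5\},\{6,1\}$. In $V_{ij}$ an arc joins the neighbouring ends $i,j$ and the other four ends meet in one vertex. $J$ consists of three disjoint arcs $12,34,56$ and $J'$ of three disjoint arcs $23,45,61$. -/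

import Mathlib

/-!
# Planar 4-valent graphs and the graphical calculus

A planar 4-valent graph is a compact subset of the plane which near each of its points is either an
arc or a (rigid) 4-valent vertex, i.e. two arcs crossing in one point; closed curves without
vertices are allowed, and the graph may be disconnected, with its components nested in any way.

Put in general position with respect to the height function, such a graph is a finite sequence of
events at distinct heights: a local minimum, a local maximum, or a vertex with two edges leaving
downwards and two edges leaving upwards; between two events there are only vertical strands.
Reading from bottom to top and recording how many strands pass to the left of each event
gives a finite word, which determines the plane graph up to planar isotopy.
Two words give isotopic plane graphs if and only if they are connected by
exchanges of the heights of two consecutive events that lie side by side, by straightening of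
zigzags, and by quarter turns of vertices.  No other move is built in: in particular the relative
position of the components, and the choice of the unbounded region, are part of the data.
-/

namespace PlanarCalculus

/-- The local events of a plane graph in general position with respect to height. -/
inductive EventKind where
  /-- a local minimum: two new strands start -/
  | cup
  /-- a local maximum: two neighbouring strands are joined and end -/
  | cap
  /-- a 4-valent vertex: two neighbouring strands come in from below, two leave upwards -/
  | vertex
  deriving DecidableEq

/-- Number of strands which enter the event from below. -/
def EventKind.below : EventKind → ℕ
  | .cup => 0
  | .cap => 2
  | .vertex => 2

/-- Number of strands which leave the event upwards. -/
def EventKind.above : EventKind → ℕ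
  | .cup => 2
  | .cap => 0
  | .vertex => 2

/-- A local event together with the number `pos` of strands that pass on its left. -/
structure Event where
  kind : EventKind
  pos : ℕ
  deriving DecidableEq

/-- A local minimum with `i` strands on its left. -/
def cup (i : ℕ) : Event := ⟨.cup, i⟩

/-- A local maximum with `i` strands on its left. -/
def cap (i : ℕ) : Event := ⟨.cap, i⟩

/-- A 4-valent vertex with `i` strands on its left. -/
def vertex (i : ℕ) : Event := ⟨.vertex, i⟩

/-- The number of strands after a word of events (read from bottom to top) has been applied to `n`
strands; `none` if some event does not find the strands that it needs. -/
def strandsAfter : ℕ → List Event → Option ℕ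
  | n, [] => some n
  | n, e :: w =>
    if e.pos + e.kind.below ≤ n then strandsAfter (n - e.kind.below + e.kind.above) w else none

/-- `IsTangle m w n`: the word `w` is a picture in a horizontal strip with `m` ends on the bottom
line and `n` ends on the top line. -/
def IsTangle (m : ℕ) (w : List Event) (n : ℕ) : Prop := strandsAfter m w = some n

instance (m : ℕ) (w : List Event) (n : ℕ) : Decidable (IsTangle m w n) :=
  inferInstanceAs (Decidable (strandsAfter m w = some n))

/-- A diagram of a nonempty planar 4-valent graph: a nonempty word of events without loose ends. -/
structure Diagram where
  events : List Event
  closed : IsTangle 0 events 0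
  nonempty : events ≠ []

/-- The elementary planar isotopies, as local changes of words. -/
inductive Move : List Event → List Event → Prop
  /-- Two consecutive events that lie side by side exchange their heights; `i` strands pass to the
  left of both and `d` strands pass between the two. -/
  | exchange (k l : EventKind) (i d : ℕ) :
      Move [⟨k, i⟩, ⟨l, i + k.above + d⟩] [⟨l, i + k.below + d⟩, ⟨k, i⟩]
  /-- A zigzag is straightened to a vertical strand. -/
  | zigzagLeft (i : ℕ) : Move [cup i, cap (i + 1)] []
  /-- The mirror image zigzag is straightened to a vertical strand. -/
  | zigzagRight (i : ℕ) : Move [cup (i + 1), cap i] []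
  /-- A vertex is rotated by a quarter turn: its upper left edge bends down to the lower left end
  of the picture, and its lower right edge bends up to the upper right end. -/
  | turnLeft (i : ℕ) : Move [cup (i + 2), vertex (i + 1), cap i] [vertex i]
  /-- A vertex is rotated by a quarter turn the other way. -/
  | turnRight (i : ℕ) : Move [cup i, vertex (i + 1), cap (i + 2)] [vertex i]

/-- Two diagrams are related by one elementary planar isotopy, performed somewhere in them. -/
def ElementaryIsotopy (D E : Diagram) : Prop :=
  ∃ u s t v : List Event, Move s t ∧ D.events = u ++ s ++ v ∧ E.events = u ++ t ++ v

/-- Nonempty planar 4-valent graphs up to planar isotopy: diagrams modulo the equivalence relation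
generated by the elementary planar isotopies. -/
def PlanarGraph : Type := Quot ElementaryIsotopy

/-- The planar graph given by a diagram. -/
def PlanarGraph.mk (D : Diagram) : PlanarGraph := Quot.mk ElementaryIsotopy D

/-- The unknot: a single circle without vertices. -/
def unknot : PlanarGraph := .mk ⟨[cup 0, cap 0], by decide, by decide⟩

/-- An event moved to the right by `j` strands. -/
def Event.shift (j : ℕ) (e : Event) : Event := ⟨e.kind, j + e.pos⟩

/-- A picture in a disc (a rectangle) with `p` ends on its bottom and `p` ends on its top. -/
structure LocalPicture (p : ℕ) where
  events : List Event
  isTangle : IsTangle p events p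

/-- The part of a plane graph outside a disc (a rectangle) which meets the graph in `p` points of
its bottom side and `p` points of its top side: what lies below, what lies above, and the numbers of
strands that pass to the left and to the right. -/
structure Surroundings (p : ℕ) where
  left : ℕ
  right : ℕ
  lower : List Event
  upper : List Event
  lower_isTangle : IsTangle 0 lower (left + p + right)
  upper_isTangle : IsTangle (left + p + right) upper 0

theorem IsTangle.append {m n r : ℕ} {u w : List Event} (hu : IsTangle m u n)
    (hw : IsTangle n w r) : IsTangle m (u ++ w) r := by
  induction u generalizing m with
  | nil =>
    simp only [IsTangle, strandsAfter, Option.some.injEq] at hu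
    subst hu
    exact hw
  | cons e u ih =>
    simp only [IsTangle, strandsAfter, List.cons_append] at hu ⊢
    split_ifs at hu ⊢ with h
    exact ih hu

theorem IsTangle.shift {m n : ℕ} {w : List Event} (hw : IsTangle m w n) (j r : ℕ) :
    IsTangle (j + m + r) (w.map (Event.shift j)) (j + n + r) := by
  induction w generalizing m with
  | nil =>
    simp only [IsTangle, strandsAfter, Option.some.injEq] at hw
    subst hw
    rfl
  | cons e w ih =>
    simp only [IsTangle, strandsAfter] at hw
    split_ifs at hw with h
    have h' : (e.shift j).pos + (e.shift j).kind.below ≤ j + m + r := by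
      simp only [Event.shift]
      omega
    have h2 : j + m + r - (e.shift j).kind.below + (e.shift j).kind.above =
        j + (m - e.kind.below + e.kind.above) + r := by
      simp only [Event.shift]
      omega
    simp only [IsTangle, strandsAfter, List.map_cons, if_pos h', h2]
    exact ih hw

/-- The planar graph obtained by inserting a local picture into its surroundings. -/
def Surroundings.fill {p : ℕ} [NeZero p] (S : Surroundings p) (T : LocalPicture p) : PlanarGraph :=
  .mk
    { events := S.lower ++ T.events.map (Event.shift S.left) ++ S.upper
      closed := (S.lower_isTangle.append (T.isTangle.shift S.left S.right)).append S.upper_isTangle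
      nonempty := by
        intro h
        have h1 : S.lower = [] := by simp_all
        have h2 := S.lower_isTangle
        rw [h1] at h2
        simp only [IsTangle, strandsAfter, Option.some.injEq] at h2
        have h3 := NeZero.ne p
        omega }

/-! ### The local pictures -/

/-- A strand. -/
def strand : LocalPicture 1 := ⟨[], by decide⟩

/-- A strand with a small circle beside it. -/
def strandWithCircle : LocalPicture 1 := ⟨[cup 0, cap 0], by decide⟩

/-- A strand which crosses itself in one vertex, forming an empty loop. -/
def strandWithLoop : LocalPicture 1 := ⟨[cup 1, vertex 0, cap 1], by decide⟩

/-- Two vertices joined by two edges which bound an empty bigon. -/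
def bigon : LocalPicture 2 := ⟨[vertex 0, vertex 0], by decide⟩

/-- A single vertex. -/
def crossing : LocalPicture 2 := ⟨[vertex 0], by decide⟩

/-- Two arcs, each of which joins an end at one vertex of the bigon to the neighbouring end at the
other vertex. -/
def alongBigon : LocalPicture 2 := ⟨[], by decide⟩

/-- Two arcs, each of which joins the two ends at the same vertex of the bigon. -/
def acrossBigon : LocalPicture 2 := ⟨[cap 0, cup 0], by decide⟩

/-! In the pictures with six ends we number the ends counterclockwise: `1, 2, 3` at the bottom from
left to right, `4, 5, 6` at the top from right to left. -/

/-- Three arcs `14`, `25`, `36` crossing each other in three vertices around an empty triangle;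
the vertices carry the ends `1, 2`, the ends `3, 4` and the ends `5, 6`. -/
def triangle12 : LocalPicture 3 := ⟨[vertex 0, vertex 1, vertex 0], by decide⟩

/-- Three arcs `14`, `25`, `36` crossing each other in three vertices around an empty triangle;
the vertices carry the ends `2, 3`, the ends `4, 5` and the ends `6, 1`. -/
def triangle23 : LocalPicture 3 := ⟨[vertex 1, vertex 0, vertex 1], by decide⟩

/-- An arc joins the ends `1, 2`; the other four ends meet in a vertex. -/
def arc12 : LocalPicture 3 := ⟨[cap 0, cup 0, vertex 1], by decide⟩

/-- An arc joins the ends `2, 3`; the other four ends meet in a vertex. -/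
def arc23 : LocalPicture 3 := ⟨[cap 1, cup 1, vertex 0], by decide⟩

/-- An arc joins the ends `3, 4`; the other four ends meet in a vertex. -/
def arc34 : LocalPicture 3 := ⟨[vertex 0], by decide⟩

/-- An arc joins the ends `4, 5`; the other four ends meet in a vertex. -/
def arc45 : LocalPicture 3 := ⟨[vertex 0, cap 1, cup 1], by decide⟩

/-- An arc joins the ends `5, 6`; the other four ends meet in a vertex. -/
def arc56 : LocalPicture 3 := ⟨[vertex 1, cap 0, cup 0], by decide⟩

/-- An arc joins the ends `6, 1`; the other four ends meet in a vertex. -/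
def arc61 : LocalPicture 3 := ⟨[vertex 1], by decide⟩

/-- Three disjoint arcs `12`, `34`, `56`. -/
def arcs12 : LocalPicture 3 := ⟨[cap 0, cup 0], by decide⟩

/-- Three disjoint arcs `23`, `45`, `61`. -/
def arcs23 : LocalPicture 3 := ⟨[cap 1, cup 1], by decide⟩

/-! ### The coefficients and the identities -/

section Coefficients

variable {K : Type*} [Field K]

/-- The coefficient `μ`. -/
def mu (A B a : K) : K := (a - a⁻¹) / (A - B) + 1

/-- The coefficient `𝒪`. -/
def loopCoeff (A B a : K) : K := (A * a⁻¹ - B * a) / (A - B) - (A + B)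

/-- The coefficient `γ`. -/
def gammaCoeff (A B a : K) : K := (B ^ 2 * a - A ^ 2 * a⁻¹) / (A - B) + A * B

/-- The coefficient `ξ`. -/
def xi (A B a : K) : K := (B ^ 3 * a - A ^ 3 * a⁻¹) / (A - B)

/-- The four identities of the graphical calculus, for a function `P` on planar 4-valent graphs:
each holds for all graphs which differ only in the marked local picture. -/
structure GraphicalCalculus (A B a : K) (P : PlanarGraph → K) : Prop where
  circle : ∀ S : Surroundings 1,
    P (S.fill strandWithCircle) = mu A B a * P (S.fill strand)
  loop : ∀ S : Surroundings 1,
    P (S.fill strandWithLoop) = loopCoeff A B a * P (S.fill strand)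
  bigon : ∀ S : Surroundings 2,
    P (S.fill bigon) = (1 - A * B) * P (S.fill alongBigon)
      + gammaCoeff A B a * P (S.fill acrossBigon) - (A + B) * P (S.fill crossing)
  triangle : ∀ S : Surroundings 3,
    P (S.fill triangle23) - P (S.fill triangle12) =
      A * B * (P (S.fill arc23) - P (S.fill arc12) + P (S.fill arc45) - P (S.fill arc34)
        + P (S.fill arc61) - P (S.fill arc56))
      + xi A B a * (P (S.fill arcs12) - P (S.fill arcs23))

end Coefficients

end PlanarCalculus

/-!
Cut a graph along a horizontal line. The lower part, read through a function on graphs that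
satisfies the calculus, becomes a functional on the possible upper parts, and a minimum, a maximum
or a vertex added on top of the lower part acts on these functionals by an operator. For every
position `i`, making a submodule stable under the vertex and the hook (a maximum followed by a
minimum) at `i` is a closure operator `Z i`. By the bigon, loop and circle relations a single
application of either suffices for this. Distant `Z i` and `Z j` commute, and the triangle relation
gives one half of the braid relation, `Z (i + 1) ∘ Z i ∘ Z (i + 1) ≤ Z i ∘ Z (i + 1) ∘ Z i`.

Hence, as with normal forms for the cosets of symmetric groups in one another, the submodules
`N (n + 2) = Z 0 (Z 1 (⋯ (Z (n - 1) (cup n (N n)))))` are stable under all vertices and hooks, and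
therefore the family `N` is stable under all minima and maxima as well. Starting from the
functional of the empty lower part, every word is thus evaluated inside a submodule which on zero
strands is spanned by the empty word and the unknot. Two functions that agree on the unknot have a
difference that vanishes there; being extended by zero to the empty word, it vanishes identically.
-/

namespace PlanarCalculus

/-! ### Braid relations for closure operators -/

section ClosureOperators

variable {α β : Type*} [PartialOrder α] [PartialOrder β]

/-- The composite `Z 0 ∘ Z 1 ∘ ⋯ ∘ Z (n - 1)` of the first `n` members of a sequence of closure
operators. When these satisfy braid relations, it turns an element closed under all but the last
of them into one that is closed under all of them; see `isClosed_sweep`. -/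
def sweep (Z : ℕ → ClosureOperator α) : ℕ → α → α
  | 0, y => y
  | n + 1, y => sweep Z n (Z n y)

variable {Z : ℕ → ClosureOperator α}

theorem sweep_mono (n : ℕ) : Monotone (sweep Z n) := by
  induction n with
  | zero => exact monotone_id
  | succ n ih => exact ih.comp (Z n).monotone

theorem le_sweep (n : ℕ) (y : α) : y ≤ sweep Z n y := by
  induction n generalizing y with
  | zero => exact le_rfl
  | succ n ih => exact ((Z n).le_closure y).trans (ih _)

theorem sweep_eq_self {n : ℕ} {y : α} (hy : ∀ i < n, (Z i).IsClosed y) : sweep Z n y = y := by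
  induction n with
  | zero => rfl
  | succ n ih =>
    rw [sweep, (hy n n.lt_succ_self).closure_eq, ih fun i hi => hy i (hi.trans n.lt_succ_self)]

theorem map_sweep {W : ℕ → ClosureOperator β} {f : α → β} {n : ℕ}
    (hf : ∀ i < n, ∀ y, f (Z i y) = W i (f y)) (y : α) : f (sweep Z n y) = sweep W n (f y) := by
  induction n generalizing y with
  | zero => rfl
  | succ n ih =>
    rw [sweep, sweep, ih fun i hi => hf i (hi.trans n.lt_succ_self), hf n n.lt_succ_self]

/-- The analogue for closure operators of the coset decomposition
`S_{n+2} = ⋃ k, s_k ⋯ s_n S_{n+1}` of symmetric groups. -/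
theorem isClosed_sweep (hcomm : ∀ i j, i + 2 ≤ j → ∀ y, Z j (Z i y) = Z i (Z j y))
    (hbraid : ∀ i y, Z (i + 1) (Z i (Z (i + 1) y)) ≤ Z i (Z (i + 1) (Z i y)))
    {n : ℕ} {y : α} (hy : ∀ i < n, (Z i).IsClosed y) :
    ∀ i ≤ n, (Z i).IsClosed (sweep Z (n + 1) y) := by
  induction n generalizing y with
  | zero =>
    intro i hi
    obtain rfl : i = 0 := by omega
    exact (Z 0).isClosed_closure y
  | succ n ih =>
    have hy' : ∀ i < n, (Z i).IsClosed (Z (n + 1) y) := by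
      intro i hi
      rw [(Z i).isClosed_iff_closure_le, ← hcomm i (n + 1) (by omega),
        (hy i (by omega)).closure_eq]
    intro i hi
    obtain hi | rfl := Nat.le_succ_iff.1 hi
    · exact ih hy' i hi
    rw [(Z (n + 1)).isClosed_iff_closure_le]
    calc Z (n + 1) (sweep Z n (Z n (Z (n + 1) y)))
        = sweep Z n (Z (n + 1) (Z n (Z (n + 1) y))) :=
          map_sweep (fun i hi => hcomm i (n + 1) (by omega)) _
      _ ≤ sweep Z n (Z n (Z (n + 1) (Z n y))) := sweep_mono n (hbraid n y)
      _ = sweep Z (n + 2) y := by rw [(hy n n.lt_succ_self).closure_eq]; rfl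

end ClosureOperators

theorem strandsAfter_append (m : ℕ) (u w : List Event) :
    strandsAfter m (u ++ w) = (strandsAfter m u).bind fun n => strandsAfter n w := by
  induction u generalizing m with
  | nil => rfl
  | cons e u ih =>
    simp only [List.cons_append, strandsAfter]
    split_ifs
    · exact ih _
    · rfl

theorem IsTangle.append_iff {m n r : ℕ} {u w : List Event} (hu : IsTangle m u n) :
    IsTangle m (u ++ w) r ↔ IsTangle n w r := by
  unfold IsTangle at *
  rw [strandsAfter_append, hu, Option.bind_some]

theorem isTangle_nil_iff {n r : ℕ} : IsTangle n [] r ↔ n = r := by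
  simp only [IsTangle, strandsAfter, Option.some.injEq]

theorem isTangle_cons_iff {n r : ℕ} {e : Event} {w : List Event} :
    IsTangle n (e :: w) r ↔
      e.pos + e.kind.below ≤ n ∧ IsTangle (n - e.kind.below + e.kind.above) w r := by
  simp only [IsTangle, strandsAfter]
  split_ifs with h <;> simp [h]

/-! ### Skein functionals -/

section Skein

variable {R : Type*} [CommRing R] {M : Type*} [AddCommGroup M] [Module R M]

/-- The coefficients of a skein theory of planar 4-valent graphs of the shape of the graphical
calculus, over an arbitrary commutative ring: those of the circle relation, of the loop relation,
of the terms of the bigon relation (`crossing` with the opposite sign) and of the two groups of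
terms of the triangle relation. -/
structure SkeinCoefficients (R : Type*) where
  circle : R
  loop : R
  along : R
  across : R
  crossing : R
  arc : R
  arcs : R

variable (c : SkeinCoefficients R)

/-- The identities of a skein theory between local pictures with `p` lower and `p` upper ends, for
a function on these pictures. -/
def SkeinIdentities : (p : ℕ) → (LocalPicture p → M) → Prop
  | 1, f => f strandWithCircle = c.circle • f strand ∧ f strandWithLoop = c.loop • f strand
  | 2, f => f bigon = c.along • f alongBigon + c.across • f acrossBigon - c.crossing • f crossing
  | 3, f => f triangle23 - f triangle12 =
      c.arc • (f arc23 - f arc12 + f arc45 - f arc34 + f arc61 - f arc56)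
        + c.arcs • (f arcs12 - f arcs23)
  | _, _ => True

variable (M) in
/-- The submodule of the functions on local pictures with `p` lower and `p` upper ends that satisfy
the identities of a skein theory. -/
def skeinIdentities (p : ℕ) : Submodule R (LocalPicture p → M) where
  carrier := {f | SkeinIdentities c p f}
  zero_mem' := match p with
    | 0 | _ + 4 => trivial
    | 1 => by simp [SkeinIdentities]
    | 2 | 3 => by simp [SkeinIdentities]
  add_mem' {f g} hf hg := match p with
    | 0 | _ + 4 => trivial
    | 1 => ⟨by simp only [Pi.add_apply, hf.1, hg.1, smul_add],
        by simp only [Pi.add_apply, hf.2, hg.2, smul_add]⟩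
    | 2 | 3 => by
      simp only [Set.mem_ofPred_eq, SkeinIdentities, Pi.add_apply] at hf hg ⊢
      linear_combination (norm := module) hf + hg
  smul_mem' a f hf := match p with
    | 0 | _ + 4 => trivial
    | 1 => ⟨by simp only [Pi.smul_apply, hf.1, smul_comm a],
        by simp only [Pi.smul_apply, hf.2, smul_comm a]⟩
    | 2 | 3 => by
      simp only [Set.mem_ofPred_eq, SkeinIdentities, Pi.smul_apply] at hf ⊢
      linear_combination (norm := module) a • hf

/-- The relations of a skein theory for a function on planar graphs: its identities hold for all
graphs that differ only inside a disc. -/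
def SkeinRelations (P : PlanarGraph → M) : Prop :=
  ∀ (p : ℕ) [NeZero p] (S : Surroundings p), (fun T => P (S.fill T)) ∈ skeinIdentities M c p

variable {c}

theorem SkeinRelations.sub {P Q : PlanarGraph → M} (hP : SkeinRelations c P)
    (hQ : SkeinRelations c Q) : SkeinRelations c (P - Q) :=
  fun p _ S => sub_mem (hP p S) (hQ p S)

theorem GraphicalCalculus.skeinRelations {K : Type*} [Field K] {A B a : K} {P : PlanarGraph → K}
    (hP : GraphicalCalculus A B a P) :
    SkeinRelations
      { circle := mu A B a
        loop := loopCoeff A B a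
        along := 1 - A * B
        across := gammaCoeff A B a
        crossing := A + B
        arc := A * B
        arcs := xi A B a } P
  | 1, _, S => ⟨hP.circle S, hP.loop S⟩
  | 2, _, S => hP.bigon S
  | 3, _, S => hP.triangle S
  | 0, _, _ | _ + 4, _, _ => trivial

variable (c) in
/-- The functionals on words that share the properties of the functional `u ↦ P (w ++ u)` of the
upper part `u` of a diagram whose lower part `w` has `n` upper ends, where `P` satisfies the skein
relations. -/
structure IsSkeinFunctional (n : ℕ) (φ : List Event → M) : Prop where
  eq_zero {u : List Event} : ¬IsTangle n u 0 → φ u = 0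
  /-- The hypothesis on the numbers of strands only rules out that an isotopy is performed where
  one of the two words is not a picture. -/
  move {p s t u : List Event} :
    Move s t → strandsAfter n (p ++ s) = strandsAfter n (p ++ t) →
      φ (p ++ (s ++ u)) = φ (p ++ (t ++ u))
  identities {m i q : ℕ} {p u : List Event} : IsTangle n p m → i + q ≤ m →
    (fun T : LocalPicture q => φ (p ++ (T.events.map (Event.shift i) ++ u))) ∈ skeinIdentities M c q

theorem IsSkeinFunctional.precomp {n m : ℕ} {φ : List Event → M} {w : List Event}
    (hφ : IsSkeinFunctional c n φ) (hw : ∀ l, IsTangle n w l → l = m) :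
    IsSkeinFunctional c m fun u => φ (w ++ u) := by
  cases h : strandsAfter n w with
  | none =>
    have h0 (u) : φ (w ++ u) = 0 := hφ.eq_zero (by simp [IsTangle, strandsAfter_append, h])
    exact
      { eq_zero := fun _ => h0 _
        move := fun _ _ => (h0 _).trans (h0 _).symm
        identities := fun _ _ => by simp only [h0]; exact zero_mem _ }
  | some l =>
    obtain rfl := hw l h
    exact
      { eq_zero := fun hu => hφ.eq_zero (mt (IsTangle.append_iff h).1 hu)
        move := fun {p s t u} hst hp => by
          have hwp : strandsAfter n (w ++ p ++ s) = strandsAfter n (w ++ p ++ t) := by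
            simpa only [List.append_assoc, strandsAfter_append n w, h, Option.bind_some] using hp
          simpa only [List.append_assoc] using hφ.move (u := u) hst hwp
        identities := fun {_ _ _ p u} hp hi => by
          simpa only [List.append_assoc] using
            hφ.identities (p := w ++ p) (u := u) (IsTangle.append h hp) hi }

variable (M c) in
/-- The module of skein functionals on the upper parts of diagrams with `n` lower ends. -/
def skeinFunctionals (n : ℕ) : Submodule R (List Event → M) where
  carrier := {φ | IsSkeinFunctional c n φ}
  zero_mem' := ⟨fun _ => rfl, fun _ _ => rfl, fun _ _ => zero_mem _⟩
  add_mem' hφ hψ :=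
    { eq_zero := fun hu => by simp only [Pi.add_apply, hφ.eq_zero hu, hψ.eq_zero hu, add_zero]
      move := fun hst h => congrArg₂ (· + ·) (hφ.move hst h) (hψ.move hst h)
      identities := fun hp hi => add_mem (hφ.identities hp hi) (hψ.identities hp hi) }
  smul_mem' a _ hφ :=
    { eq_zero := fun hu => by simp only [Pi.smul_apply, hφ.eq_zero hu, smul_zero]
      move := fun hst h => congrArg (a • ·) (hφ.move hst h)
      identities := fun hp hi => Submodule.smul_mem _ a (hφ.identities hp hi) }

/-- The operator that moves a word `w` with `n` lower and `m` upper ends from the upper to the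
lower part. The condition `hw` says nothing if `w` does not fit on `n` strands, in which case the
operator is zero. -/
def wordMap {n m : ℕ} (w : List Event) (hw : ∀ l, IsTangle n w l → l = m) :
    skeinFunctionals M c n →ₗ[R] skeinFunctionals M c m :=
  (LinearMap.funLeft R M (w ++ ·)).restrict fun _ hφ => hφ.precomp hw

theorem IsTangle.eq_of_singleton {n m l : ℕ} {e : Event}
    (hm : n + e.kind.above = m + e.kind.below) (h : IsTangle n [e] l) : l = m := by
  simp only [isTangle_cons_iff, isTangle_nil_iff] at h
  omega

theorem IsTangle.eq_of_hook {i n l : ℕ} (h : IsTangle n [cap i, cup i] l) : l = n := by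
  simp only [isTangle_cons_iff, isTangle_nil_iff, cap, cup, EventKind.below, EventKind.above] at h
  omega

/-- The operator given by a local minimum. -/
def cupMap (i : ℕ) {n : ℕ} : skeinFunctionals M c n →ₗ[R] skeinFunctionals M c (n + 2) :=
  wordMap [cup i] fun _ => IsTangle.eq_of_singleton rfl

/-- The operator given by a local maximum. -/
def capMap (i : ℕ) {n : ℕ} : skeinFunctionals M c (n + 2) →ₗ[R] skeinFunctionals M c n :=
  wordMap [cap i] fun _ => IsTangle.eq_of_singleton rfl

/-- The operator given by a vertex. -/
def vertexMap (i : ℕ) {n : ℕ} : skeinFunctionals M c n →ₗ[R] skeinFunctionals M c n :=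
  wordMap [vertex i] fun _ => IsTangle.eq_of_singleton rfl

/-- The operator given by a local maximum with a local minimum above it: a generator of the
Temperley–Lieb algebra. -/
def hookMap (i : ℕ) {n : ℕ} : skeinFunctionals M c n →ₗ[R] skeinFunctionals M c n :=
  wordMap [cap i, cup i] fun _ => IsTangle.eq_of_hook

variable {n m i j : ℕ}

theorem wordMap_eq_zero {w : List Event} (hw : ∀ l, IsTangle n w l → l = m)
    (h : ∀ l, ¬IsTangle n w l) : (wordMap w hw : skeinFunctionals M c n →ₗ[R] _) = 0 := by
  ext φ u
  have hnone : strandsAfter n w = none := Option.eq_none_iff_forall_ne_some.2 h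
  exact φ.2.eq_zero (by simp [IsTangle, strandsAfter_append, hnone])

theorem vertexMap_eq_zero (h : n < i + 2) : (vertexMap i : skeinFunctionals M c n →ₗ[R] _) = 0 :=
  wordMap_eq_zero _ fun _ hl => h.not_ge (isTangle_cons_iff.1 hl).1

theorem hookMap_eq_zero (h : n < i + 2) : (hookMap i : skeinFunctionals M c n →ₗ[R] _) = 0 :=
  wordMap_eq_zero _ fun _ hl => h.not_ge (isTangle_cons_iff.1 hl).1

theorem hookMap_apply (φ : skeinFunctionals M c (n + 2)) :
    hookMap i φ = cupMap i (capMap i φ) := rfl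

theorem strandsAfter_exchange (k l : EventKind) (n i d : ℕ) :
    strandsAfter n [⟨k, i⟩, ⟨l, i + k.above + d⟩] =
      strandsAfter n [⟨l, i + k.below + d⟩, ⟨k, i⟩] := by
  cases k <;> cases l <;> grind [strandsAfter, EventKind.below, EventKind.above]

theorem apply_exchange (φ : skeinFunctionals M c n) (k l : EventKind) (hij : i ≤ j)
    (p u : List Event) :
    φ.1 (p ++ ⟨k, i⟩ :: ⟨l, j + k.above⟩ :: u) = φ.1 (p ++ ⟨l, j + k.below⟩ :: ⟨k, i⟩ :: u) := by
  obtain ⟨d, rfl⟩ := Nat.exists_eq_add_of_le hij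
  rw [Nat.add_right_comm i d, Nat.add_right_comm i d]
  refine φ.2.move (.exchange k l i d) ?_
  rw [strandsAfter_append, strandsAfter_append]
  exact congrArg _ (funext fun n => strandsAfter_exchange k l n i d)

theorem apply_move (φ : skeinFunctionals M c n) {s t : List Event} (hst : Move s t)
    (h : strandsAfter n s = strandsAfter n t) (u : List Event) : φ.1 (s ++ u) = φ.1 (t ++ u) :=
  φ.2.move (p := []) hst h

theorem apply_identities (φ : skeinFunctionals M c n) {q : ℕ} (h : i + q ≤ n) (u : List Event) :
    (fun T : LocalPicture q => φ.1 (T.events.map (Event.shift i) ++ u)) ∈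
      skeinIdentities M c q :=
  φ.2.identities (p := []) rfl h

/-! ### Relations between minima, maxima, vertices and hooks -/

theorem cupMap_cupMap (hij : i ≤ j) (φ : skeinFunctionals M c n) :
    cupMap (j + 2) (cupMap i φ) = cupMap i (cupMap j φ) :=
  Subtype.ext <| funext fun u => apply_exchange φ .cup .cup hij [] u

theorem capMap_cupMap (hij : i ≤ j) (φ : skeinFunctionals M c (n + 2)) :
    capMap (j + 2) (cupMap i φ) = cupMap i (capMap j φ) :=
  Subtype.ext <| funext fun u => apply_exchange φ .cup .cap hij [] u

theorem capMap_capMap (hij : i ≤ j) (φ : skeinFunctionals M c (n + 4)) :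
    capMap j (capMap i φ) = capMap i (capMap (j + 2) φ) :=
  Subtype.ext <| funext fun u => apply_exchange φ .cap .cap hij [] u

theorem wordMap_vertexMap (hij : i ≤ j) {l : EventKind}
    (h : ∀ k, IsTangle n [⟨l, j + 2⟩] k → k = m) (φ : skeinFunctionals M c n) :
    wordMap _ h (vertexMap i φ) = vertexMap i (wordMap _ h φ) :=
  Subtype.ext <| funext fun u => apply_exchange φ .vertex l hij [] u

theorem wordMap_hookMap (hij : i ≤ j) {l : EventKind}
    (h : ∀ k, IsTangle n [⟨l, j + 2⟩] k → k = m) (φ : skeinFunctionals M c n) :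
    wordMap _ h (hookMap i φ) = hookMap i (wordMap _ h φ) :=
  Subtype.ext <| funext fun u =>
    (apply_exchange φ .cup l hij [cap i] u).trans
      (apply_exchange φ .cap l hij [] (cup i :: u))

theorem capMap_succ_cupMap (h : i + 1 ≤ n) (φ : skeinFunctionals M c n) :
    capMap (i + 1) (cupMap i φ) = φ :=
  Subtype.ext <| funext <| apply_move φ (.zigzagLeft i) <| by
    grind [strandsAfter, cup, cap, EventKind.below, EventKind.above]

theorem capMap_cupMap_succ (h : i + 1 ≤ n) (φ : skeinFunctionals M c n) :
    capMap i (cupMap (i + 1) φ) = φ :=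
  Subtype.ext <| funext <| apply_move φ (.zigzagRight i) <| by
    grind [strandsAfter, cup, cap, EventKind.below, EventKind.above]

theorem capMap_vertexMap_cupMap_left (φ : skeinFunctionals M c n) :
    capMap i (vertexMap (i + 1) (cupMap (i + 2) φ)) = vertexMap i φ :=
  Subtype.ext <| funext <| apply_move φ (.turnLeft i) <| by
    grind [strandsAfter, cup, cap, vertex, EventKind.below, EventKind.above]

theorem capMap_vertexMap_cupMap_right (φ : skeinFunctionals M c n) :
    capMap (i + 2) (vertexMap (i + 1) (cupMap i φ)) = vertexMap i φ :=
  Subtype.ext <| funext <| apply_move φ (.turnRight i) <| by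
    grind [strandsAfter, cup, cap, vertex, EventKind.below, EventKind.above]

theorem capMap_cupMap_self (h : i + 1 ≤ n) (φ : skeinFunctionals M c n) :
    capMap i (cupMap i φ) = c.circle • φ :=
  Subtype.ext <| funext fun u => (apply_identities φ h u).1

theorem capMap_vertexMap_cupMap (h : i + 1 ≤ n) (φ : skeinFunctionals M c n) :
    capMap (i + 1) (vertexMap i (cupMap (i + 1) φ)) = c.loop • φ :=
  Subtype.ext <| funext fun u => (apply_identities φ h u).2

theorem vertexMap_vertexMap (h : i + 2 ≤ n) (φ : skeinFunctionals M c n) :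
    vertexMap i (vertexMap i φ) =
      c.along • φ + c.across • hookMap i φ - c.crossing • vertexMap i φ :=
  Subtype.ext <| funext fun u => apply_identities φ h u

theorem vertexMap_braid (h : i + 3 ≤ n) (φ : skeinFunctionals M c n) :
    vertexMap (i + 1) (vertexMap i (vertexMap (i + 1) φ)) -
        vertexMap i (vertexMap (i + 1) (vertexMap i φ)) =
      c.arc • (vertexMap i (hookMap (i + 1) φ) - vertexMap (i + 1) (hookMap i φ)
          + hookMap (i + 1) (vertexMap i φ) - vertexMap i φ
          + vertexMap (i + 1) φ - hookMap i (vertexMap (i + 1) φ))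
        + c.arcs • (hookMap i φ - hookMap (i + 1) φ) :=
  Subtype.ext <| funext fun u => apply_identities φ h u

/-- Rotate the vertex by a quarter turn and straighten the resulting zigzag. -/
theorem vertexMap_cupMap_succ (h : i + 1 ≤ n) (φ : skeinFunctionals M c n) :
    vertexMap i (cupMap (i + 1) φ) = vertexMap (i + 1) (cupMap i φ) :=
  calc vertexMap i (cupMap (i + 1) φ)
      = capMap (i + 2) (vertexMap (i + 1) (cupMap i (cupMap (i + 1) φ))) :=
        (capMap_vertexMap_cupMap_right _).symm
    _ = capMap (i + 2) (vertexMap (i + 1) (cupMap (i + 3) (cupMap i φ))) := by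
        rw [← cupMap_cupMap (Nat.le_succ i)]
    _ = capMap (i + 2) (cupMap (i + 3) (vertexMap (i + 1) (cupMap i φ))) :=
        congrArg (capMap (i + 2)) (wordMap_vertexMap le_rfl _ _).symm
    _ = vertexMap (i + 1) (cupMap i φ) := capMap_cupMap_succ (by omega) _

theorem capMap_succ_vertexMap (h : i + 1 ≤ n) (φ : skeinFunctionals M c (n + 2)) :
    capMap (i + 1) (vertexMap i φ) = capMap i (vertexMap (i + 1) φ) :=
  calc capMap (i + 1) (vertexMap i φ)
      = capMap (i + 1) (capMap i (vertexMap (i + 1) (cupMap (i + 2) φ))) := by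
        rw [capMap_vertexMap_cupMap_left]
    _ = capMap i (capMap (i + 3) (vertexMap (i + 1) (cupMap (i + 2) φ))) :=
        capMap_capMap (Nat.le_succ i) _
    _ = capMap i (vertexMap (i + 1) (capMap (i + 3) (cupMap (i + 2) φ))) :=
        congrArg (capMap i) (wordMap_vertexMap le_rfl _ _)
    _ = capMap i (vertexMap (i + 1) φ) := by rw [capMap_succ_cupMap (by omega)]

theorem vertexMap_cupMap_self (h : i ≤ n) (φ : skeinFunctionals M c n) :
    vertexMap i (cupMap i φ) = c.loop • cupMap i φ := by
  rw [← capMap_vertexMap_cupMap_right, ← cupMap_cupMap le_rfl,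
    capMap_vertexMap_cupMap (by omega)]

theorem capMap_vertexMap_self (h : i ≤ n) (φ : skeinFunctionals M c (n + 2)) :
    capMap i (vertexMap i φ) = c.loop • capMap i φ := by
  rw [← capMap_vertexMap_cupMap_left, capMap_capMap le_rfl, capMap_vertexMap_cupMap (by omega),
    map_smul]

/-- The circle is moved past the maximum, to the left of the strand that ends there. -/
theorem capMap_cupMap_capMap (h : i ≤ n) (φ : skeinFunctionals M c (n + 2)) :
    capMap i (cupMap i (capMap i φ)) = c.circle • capMap i φ := by
  rw [← capMap_cupMap le_rfl, ← capMap_capMap le_rfl, capMap_cupMap_self (by omega), map_smul]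

theorem capMap_succ_cupMap_succ (h : i + 1 ≤ n) (φ : skeinFunctionals M c n) :
    capMap (i + 1) (cupMap (i + 1) φ) = c.circle • φ := by
  simpa only [capMap_succ_cupMap h] using capMap_cupMap_capMap h (cupMap i φ)

theorem hookMap_cupMap_succ (h : i + 1 ≤ n) (φ : skeinFunctionals M c n) :
    hookMap i (cupMap (i + 1) φ) = cupMap i φ := by
  rw [hookMap_apply, capMap_cupMap_succ h]

theorem hookMap_succ_cupMap (h : i + 1 ≤ n) (φ : skeinFunctionals M c n) :
    hookMap (i + 1) (cupMap i φ) = cupMap (i + 1) φ := by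
  rw [hookMap_apply, capMap_succ_cupMap h]

theorem capMap_succ_hookMap (h : i + 1 ≤ n) (φ : skeinFunctionals M c (n + 2)) :
    capMap (i + 1) (hookMap i φ) = capMap i φ := by
  rw [hookMap_apply, capMap_succ_cupMap h]

theorem hookMap_hookMap (h : i ≤ n) (φ : skeinFunctionals M c (n + 2)) :
    hookMap i (hookMap i φ) = c.circle • hookMap i φ := by
  simp only [hookMap_apply, capMap_cupMap_capMap h, map_smul]

theorem vertexMap_hookMap (h : i ≤ n) (φ : skeinFunctionals M c (n + 2)) :
    vertexMap i (hookMap i φ) = c.loop • hookMap i φ := by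
  rw [hookMap_apply, vertexMap_cupMap_self h]

theorem hookMap_vertexMap (h : i ≤ n) (φ : skeinFunctionals M c (n + 2)) :
    hookMap i (vertexMap i φ) = c.loop • hookMap i φ := by
  simp only [hookMap_apply, capMap_vertexMap_self h, map_smul]

theorem vertexMap_vertexMap_cupMap (h : i + 1 ≤ n) (φ : skeinFunctionals M c n) :
    vertexMap (i + 1) (vertexMap i (cupMap (i + 1) φ)) =
      c.along • cupMap i φ + c.across • cupMap (i + 1) φ
        - c.crossing • vertexMap i (cupMap (i + 1) φ) := by
  rw [vertexMap_cupMap_succ h, vertexMap_vertexMap (by omega), hookMap_succ_cupMap h]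

theorem hookMap_succ_vertexMap_cupMap (h : i + 1 ≤ n) (φ : skeinFunctionals M c n) :
    hookMap (i + 1) (vertexMap i (cupMap (i + 1) φ)) = c.loop • cupMap (i + 1) φ := by
  rw [hookMap_apply, capMap_vertexMap_cupMap h, map_smul]

theorem vertexMap_hookMap_vertexMap (h : i + 1 ≤ n) (φ : skeinFunctionals M c (n + 2)) :
    vertexMap (i + 1) (hookMap i (vertexMap (i + 1) φ)) =
      vertexMap i (hookMap (i + 1) (vertexMap i φ)) := by
  simp only [hookMap_apply, ← capMap_succ_vertexMap h, vertexMap_cupMap_succ h]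

theorem hookMap_hookMap_vertexMap (h : i + 1 ≤ n) (φ : skeinFunctionals M c (n + 2)) :
    hookMap (i + 1) (hookMap i (vertexMap (i + 1) φ)) = hookMap (i + 1) (vertexMap i φ) := by
  simp only [hookMap_apply, capMap_succ_cupMap h, capMap_succ_vertexMap h]

theorem hookMap_vertexMap_vertexMap (h : i + 1 ≤ n) (φ : skeinFunctionals M c (n + 2)) :
    hookMap (i + 1) (vertexMap i (vertexMap (i + 1) φ)) =
      c.along • hookMap (i + 1) (hookMap i φ) + c.across • hookMap (i + 1) φ
        - c.crossing • hookMap (i + 1) (vertexMap i φ) := by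
  have hi : i + 1 + 2 ≤ n + 2 := by omega
  simp only [hookMap_apply, capMap_succ_vertexMap h, vertexMap_vertexMap hi, map_add, map_sub,
    map_smul, capMap_succ_cupMap h, capMap_cupMap_succ h]

/-! ### The closure operator of a position -/

theorem map_hookMap (Y : Submodule R (skeinFunctionals M c (n + 2))) :
    Y.map (hookMap i) = (Y.map (capMap i)).map (cupMap i) :=
  Y.map_comp (capMap i) (cupMap i)

variable {X Y : Submodule R (skeinFunctionals M c n)} {φ : skeinFunctionals M c n}

theorem mem_sup_map_map (i : ℕ) :
    ∀ φ ∈ Y ⊔ Y.map (vertexMap i) ⊔ Y.map (hookMap i),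
      vertexMap i φ ∈ Y ⊔ Y.map (vertexMap i) ⊔ Y.map (hookMap i) ∧
        hookMap i φ ∈ Y ⊔ Y.map (vertexMap i) ⊔ Y.map (hookMap i) := by
  obtain hi | hi := lt_or_ge n (i + 2)
  · simp only [vertexMap_eq_zero hi, hookMap_eq_zero hi, LinearMap.zero_apply, zero_mem,
      and_self, implies_true]
  obtain ⟨n, rfl⟩ : ∃ k, n = k + 2 := ⟨n - 2, by omega⟩
  replace hi : i ≤ n := by omega
  set Z := Y ⊔ Y.map (vertexMap i) ⊔ Y.map (hookMap i)
  have hY {φ} (hφ : φ ∈ Y) : φ ∈ Z :=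
    Submodule.mem_sup_left (Submodule.mem_sup_left hφ)
  have hv {φ} (hφ : φ ∈ Y) : vertexMap i φ ∈ Z :=
    Submodule.mem_sup_left (Submodule.mem_sup_right (Submodule.mem_map_of_mem hφ))
  have hh {φ} (hφ : φ ∈ Y) : hookMap i φ ∈ Z :=
    Submodule.mem_sup_right (Submodule.mem_map_of_mem hφ)
  suffices Z ≤ Z.comap (vertexMap i) ⊓ Z.comap (hookMap i) from this
  refine sup_le (sup_le (fun φ hφ => ⟨hv hφ, hh hφ⟩) ?_) ?_
  · rintro _ ⟨φ, hφ, rfl⟩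
    rw [Submodule.mem_inf, Submodule.mem_comap, Submodule.mem_comap,
      vertexMap_vertexMap (by omega), hookMap_vertexMap hi]
    exact ⟨sub_mem (add_mem (Z.smul_mem _ (hY hφ)) (Z.smul_mem _ (hh hφ)))
      (Z.smul_mem _ (hv hφ)), Z.smul_mem _ (hh hφ)⟩
  · rintro _ ⟨φ, hφ, rfl⟩
    rw [Submodule.mem_inf, Submodule.mem_comap, Submodule.mem_comap,
      vertexMap_hookMap hi, hookMap_hookMap hi]
    exact ⟨Z.smul_mem _ (hh hφ), Z.smul_mem _ (hh hφ)⟩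

/-- The closure operator whose closed submodules are those stable under the vertex and the hook at
position `i`. By the circle, loop and bigon relations one application of each suffices. -/
def localClosure {n : ℕ} (i : ℕ) : ClosureOperator (Submodule R (skeinFunctionals M c n)) :=
  .ofPred (fun Y => Y ⊔ Y.map (vertexMap i) ⊔ Y.map (hookMap i))
    (fun Y => ∀ φ ∈ Y, vertexMap i φ ∈ Y ∧ hookMap i φ ∈ Y)
    (fun _ => le_sup_of_le_left le_sup_left) (fun _ => mem_sup_map_map i)
    fun _ _ hXY hY => sup_le (sup_le hXY (Submodule.map_le_iff_le_comap.2 fun φ hφ =>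
      (hY φ (hXY hφ)).1)) (Submodule.map_le_iff_le_comap.2 fun φ hφ => (hY φ (hXY hφ)).2)

theorem localClosure_apply (i : ℕ) (Y : Submodule R (skeinFunctionals M c n)) :
    localClosure i Y = Y ⊔ Y.map (vertexMap i) ⊔ Y.map (hookMap i) := rfl

theorem vertexMap_mem (hY : (localClosure i).IsClosed Y) (hφ : φ ∈ Y) : vertexMap i φ ∈ Y :=
  (hY φ hφ).1

theorem hookMap_mem (hY : (localClosure i).IsClosed Y) (hφ : φ ∈ Y) : hookMap i φ ∈ Y :=
  (hY φ hφ).2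

theorem localClosure_le_iff :
    localClosure i X ≤ Y ↔ X ≤ Y ⊓ Y.comap (vertexMap i) ⊓ Y.comap (hookMap i) := by
  simp only [localClosure_apply, sup_le_iff, le_inf_iff, Submodule.map_le_iff_le_comap]

theorem localClosure_localClosure_le_iff :
    localClosure j (localClosure i X) ≤ Y ↔ ∀ φ ∈ X,
      (φ ∈ Y ∧ vertexMap j φ ∈ Y ∧ hookMap j φ ∈ Y) ∧
      (vertexMap i φ ∈ Y ∧ vertexMap j (vertexMap i φ) ∈ Y ∧ hookMap j (vertexMap i φ) ∈ Y) ∧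
      (hookMap i φ ∈ Y ∧ vertexMap j (hookMap i φ) ∈ Y ∧ hookMap j (hookMap i φ) ∈ Y) := by
  rw [localClosure_le_iff, localClosure_le_iff]
  simp only [SetLike.le_def, Submodule.mem_inf, Submodule.mem_comap, and_assoc]

theorem localClosure_eq_self (h : n < i + 2) : localClosure i Y = Y := by
  simp only [localClosure_apply, vertexMap_eq_zero h, hookMap_eq_zero h, Submodule.map_zero,
    sup_bot_eq]

theorem localClosure_sup : localClosure i (X ⊔ Y) = localClosure i X ⊔ localClosure i Y := by
  simp only [localClosure_apply, Submodule.map_sup]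
  ac_rfl

theorem map_localClosure {f : skeinFunctionals M c n →ₗ[R] skeinFunctionals M c m}
    (hv : f ∘ₗ vertexMap i = vertexMap i ∘ₗ f) (hh : f ∘ₗ hookMap i = hookMap i ∘ₗ f)
    (Y : Submodule R (skeinFunctionals M c n)) :
    (localClosure i Y).map f = localClosure i (Y.map f) := by
  simp only [localClosure_apply, Submodule.map_sup, ← Submodule.map_comp, hv, hh]

theorem map_wordMap_localClosure {l : EventKind} (hij : i + 2 ≤ j)
    (h : ∀ k, IsTangle n [⟨l, j⟩] k → k = m) (Y : Submodule R (skeinFunctionals M c n)) :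
    (localClosure i Y).map (wordMap _ h) = localClosure i (Y.map (wordMap _ h)) := by
  obtain ⟨d, rfl⟩ := Nat.exists_eq_add_of_le' hij
  have hid : i ≤ d + i := Nat.le_add_left i d
  exact map_localClosure (LinearMap.ext (wordMap_vertexMap hid h))
    (LinearMap.ext (wordMap_hookMap hid h)) Y

theorem localClosure_comm (hij : i + 2 ≤ j) (Y : Submodule R (skeinFunctionals M c n)) :
    localClosure j (localClosure i Y) = localClosure i (localClosure j Y) := by
  obtain hj | hj := lt_or_ge n (j + 2)
  · rw [localClosure_eq_self hj, localClosure_eq_self hj]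
  obtain ⟨n, rfl⟩ : ∃ k, n = k + 2 := ⟨n - 2, by omega⟩
  have hv : (localClosure i Y).map (vertexMap j) = localClosure i (Y.map (vertexMap j)) :=
    map_wordMap_localClosure hij _ Y
  have hcap : (localClosure i Y).map (capMap j) = localClosure i (Y.map (capMap j)) :=
    map_wordMap_localClosure hij _ Y
  have hcup (X : Submodule R (skeinFunctionals M c n)) :
      (localClosure i X).map (cupMap j) = localClosure i (X.map (cupMap j)) :=
    map_wordMap_localClosure hij _ X
  have hh : (localClosure i Y).map (hookMap j) = localClosure i (Y.map (hookMap j)) := by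
    rw [map_hookMap, hcap, hcup, ← map_hookMap]
  rw [localClosure_apply j Y, localClosure_sup, localClosure_sup, ← hv, ← hh, localClosure_apply j]

theorem isClosed_localClosure_map_cupMap (h : i + 1 ≤ n) :
    (localClosure (i + 1)).IsClosed (localClosure i (Y.map (cupMap (i + 1)))) := by
  rw [ClosureOperator.isClosed_iff_closure_le, localClosure_localClosure_le_iff]
  rintro _ ⟨φ, hφ, rfl⟩
  set Z := localClosure i (Y.map (cupMap (i + 1)))
  have hZ : (localClosure i).IsClosed Z := ClosureOperator.isClosed_closure _ _
  have hcup : cupMap (i + 1) φ ∈ Z :=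
    (localClosure i).le_closure _ (Submodule.mem_map_of_mem hφ)
  have hcup' : cupMap i φ ∈ Z := by
    simpa only [hookMap_cupMap_succ h] using hookMap_mem hZ hcup
  have hv : vertexMap i (cupMap (i + 1) φ) ∈ Z := vertexMap_mem hZ hcup
  rw [vertexMap_cupMap_self h, hookMap_apply, capMap_succ_cupMap_succ h, map_smul,
    vertexMap_vertexMap_cupMap h, hookMap_succ_vertexMap_cupMap h, hookMap_cupMap_succ h,
    ← vertexMap_cupMap_succ h, hookMap_succ_cupMap h]
  exact ⟨⟨hcup, Z.smul_mem _ hcup, Z.smul_mem _ hcup⟩,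
    ⟨hv, sub_mem (add_mem (Z.smul_mem _ hcup') (Z.smul_mem _ hcup)) (Z.smul_mem _ hv),
      Z.smul_mem _ hcup⟩, hcup', hv, hcup⟩

theorem localClosure_map_vertexMap_le {Y T : Submodule R (skeinFunctionals M c (n + 2))}
    (h : i + 1 ≤ n) (hT : (localClosure i).IsClosed T)
    (hYT : localClosure (i + 1) (localClosure i Y) ≤ T) :
    localClosure (i + 1) (localClosure i (Y.map (vertexMap (i + 1)))) ≤ T := by
  rw [localClosure_localClosure_le_iff] at hYT ⊢
  rintro _ ⟨φ, hφ, rfl⟩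
  obtain ⟨⟨hφ, hv₁, hh₁⟩, ⟨hv₀, hv₁v₀, hh₁v₀⟩, hh₀, hv₁h₀, hh₁h₀⟩ := hYT φ hφ
  have hv₀v₁ := vertexMap_mem hT hv₁
  have hh₀v₁ := hookMap_mem hT hv₁
  refine ⟨⟨hv₁, ?_, ?_⟩, ⟨hv₀v₁, ?_, ?_⟩, hh₀v₁, ?_, ?_⟩
  · rw [vertexMap_vertexMap (by omega)]
    exact sub_mem (add_mem (T.smul_mem _ hφ) (T.smul_mem _ hh₁)) (T.smul_mem _ hv₁)
  · rw [hookMap_vertexMap h]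
    exact T.smul_mem _ hh₁
  · rw [← T.sub_mem_iff_left (vertexMap_mem hT hv₁v₀), vertexMap_braid (by omega)]
    refine add_mem (T.smul_mem _ ?_) (T.smul_mem _ (sub_mem hh₀ hh₁))
    exact sub_mem (add_mem (sub_mem (add_mem (sub_mem (vertexMap_mem hT hh₁) hv₁h₀) hh₁v₀) hv₀)
      hv₁) hh₀v₁
  · rw [hookMap_vertexMap_vertexMap h]
    exact sub_mem (add_mem (T.smul_mem _ hh₁h₀) (T.smul_mem _ hh₁)) (T.smul_mem _ hh₁v₀)
  · rw [vertexMap_hookMap_vertexMap h]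
    exact vertexMap_mem hT hh₁v₀
  · rwa [hookMap_hookMap_vertexMap h]

theorem localClosure_braid (i : ℕ) (Y : Submodule R (skeinFunctionals M c n)) :
    localClosure (i + 1) (localClosure i (localClosure (i + 1) Y)) ≤
      localClosure i (localClosure (i + 1) (localClosure i Y)) := by
  obtain hi | hi := lt_or_ge n (i + 1 + 2)
  · simp only [localClosure_eq_self hi, ClosureOperator.idempotent, le_refl]
  obtain ⟨n, rfl⟩ : ∃ k, n = k + 2 := ⟨n - 2, by omega⟩
  replace hi : i + 1 ≤ n := by omega
  set T := localClosure i (localClosure (i + 1) (localClosure i Y))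
  have hYT : localClosure (i + 1) (localClosure i Y) ≤ T := (localClosure i).le_closure _
  have hT : (localClosure i).IsClosed T := ClosureOperator.isClosed_closure _ _
  have hhook : localClosure (i + 1) (localClosure i (Y.map (hookMap (i + 1)))) ≤ T := by
    rw [map_hookMap, (isClosed_localClosure_map_cupMap hi).closure_eq, ← map_hookMap]
    refine (localClosure i).monotone ((le_sup_right : _ ≤ localClosure (i + 1) Y).trans ?_)
    exact (localClosure (i + 1)).monotone ((localClosure i).le_closure Y)
  rw [localClosure_apply (i + 1) Y]
  simp only [localClosure_sup]
  exact sup_le (sup_le hYT (localClosure_map_vertexMap_le hi hT hYT)) hhook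

/-! ### Normal forms -/

variable (φ₀ : skeinFunctionals M c 0)

/-- The functionals that arise from `φ₀` by the events of arbitrary lower parts with `n` upper ends,
spanned by the normal forms of such lower parts. -/
def normalSpace : (n : ℕ) → Submodule R (skeinFunctionals M c n)
  | 0 => Submodule.span R {φ₀, capMap 0 (cupMap 0 φ₀)}
  | 1 => ⊥
  | n + 2 => sweep localClosure n ((normalSpace n).map (cupMap n))

variable {φ₀}

theorem capMap_cupMap_mem_normalSpace {φ : skeinFunctionals M c 0} (hφ : φ ∈ normalSpace φ₀ 0) :
    capMap 0 (cupMap 0 φ) ∈ normalSpace φ₀ 0 := by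
  suffices h : normalSpace φ₀ 0 ≤ (normalSpace φ₀ 0).comap (capMap 0 ∘ₗ cupMap 0) from h hφ
  refine Submodule.span_le.2 (Set.pair_subset ?_ ?_)
  · exact Submodule.subset_span (Set.mem_insert_of_mem _ rfl)
  · change capMap 0 (cupMap 0 (capMap 0 (cupMap 0 φ₀))) ∈ normalSpace φ₀ 0
    rw [capMap_cupMap_capMap le_rfl]
    exact Submodule.smul_mem _ _ (Submodule.subset_span (Set.mem_insert_of_mem _ rfl))

theorem isClosed_normalSpace_two : (localClosure 0).IsClosed (normalSpace φ₀ 2) := by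
  rintro _ ⟨φ, hφ, rfl⟩
  rw [vertexMap_cupMap_self le_rfl, hookMap_apply]
  exact ⟨Submodule.smul_mem _ _ (Submodule.mem_map_of_mem hφ),
    Submodule.mem_map_of_mem (capMap_cupMap_mem_normalSpace hφ)⟩

theorem isClosed_normalSpace (h : i + 2 ≤ n) : (localClosure i).IsClosed (normalSpace φ₀ n) := by
  induction n using Nat.twoStepInduction generalizing i with
  | zero | one => omega
  | more n ih _ =>
    cases n with
    | zero =>
      obtain rfl : i = 0 := by omega
      exact isClosed_normalSpace_two
    | succ n =>
      set Y := (normalSpace φ₀ (n + 1)).map (cupMap (n + 1))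
      have hY (k : ℕ) (hk : k < n) : (localClosure k).IsClosed Y := by
        rw [ClosureOperator.isClosed_iff]
        calc localClosure k Y
            = (localClosure k (normalSpace φ₀ (n + 1))).map (cupMap (n + 1)) :=
              (map_wordMap_localClosure (by omega) _ _).symm
          _ = Y := by rw [(ih (by omega)).closure_eq]
      obtain hi | rfl := Nat.lt_or_eq_of_le (show i ≤ n + 1 by omega)
      · exact isClosed_sweep (fun _ _ => localClosure_comm) localClosure_braid hY i (by omega)
      · rw [ClosureOperator.isClosed_iff]
        calc localClosure (n + 1) (sweep localClosure n (localClosure n Y))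
            = sweep localClosure n (localClosure (n + 1) (localClosure n Y)) :=
              map_sweep (fun k hk => localClosure_comm (by omega)) _
          _ = sweep localClosure n (localClosure n Y) := by
              rw [(isClosed_localClosure_map_cupMap (by omega)).closure_eq]

theorem cupMap_mem_normalSpace (h : i ≤ n) {φ : skeinFunctionals M c n}
    (hφ : φ ∈ normalSpace φ₀ n) : cupMap i φ ∈ normalSpace φ₀ (n + 2) := by
  induction h using Nat.decreasingInduction with
  | self =>
    have hle : (normalSpace φ₀ n).map (cupMap n) ≤ normalSpace φ₀ (n + 2) := le_sweep n _
    exact hle (Submodule.mem_map_of_mem hφ)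
  | of_succ i hi ih =>
    rw [← hookMap_cupMap_succ hi]
    exact hookMap_mem (isClosed_normalSpace (by omega)) ih

theorem map_capMap_localClosure_le (h : i + 1 ≤ n) (Y : Submodule R (skeinFunctionals M c n)) :
    (localClosure i (Y.map (cupMap (i + 1)))).map (capMap (i + 1)) ≤ Y := by
  rw [Submodule.map_le_iff_le_comap, localClosure_le_iff]
  rintro _ ⟨φ, hφ, rfl⟩
  simp only [Submodule.mem_inf, Submodule.mem_comap, capMap_succ_cupMap_succ h,
    capMap_vertexMap_cupMap h, hookMap_cupMap_succ h, capMap_succ_cupMap h]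
  exact ⟨⟨Y.smul_mem _ hφ, Y.smul_mem _ hφ⟩, hφ⟩

theorem map_capMap_normalSpace_le :
    (normalSpace φ₀ (n + 2)).map (capMap n) ≤ normalSpace φ₀ n := by
  cases n with
  | zero =>
    rintro _ ⟨_, ⟨φ, hφ, rfl⟩, rfl⟩
    exact capMap_cupMap_mem_normalSpace hφ
  | succ n =>
    set Y := (normalSpace φ₀ (n + 1)).map (cupMap (n + 1))
    calc (sweep localClosure n (localClosure n Y)).map (capMap (n + 1))
        = sweep localClosure n ((localClosure n Y).map (capMap (n + 1))) :=
          map_sweep (f := Submodule.map (capMap (n + 1)))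
            (fun k hk => map_wordMap_localClosure (by omega) _) _
      _ ≤ sweep localClosure n (normalSpace φ₀ (n + 1)) :=
          sweep_mono n (map_capMap_localClosure_le le_rfl _)
      _ = normalSpace φ₀ (n + 1) := sweep_eq_self fun k hk => isClosed_normalSpace (by omega)

theorem capMap_mem_normalSpace (h : i ≤ n) {φ : skeinFunctionals M c (n + 2)}
    (hφ : φ ∈ normalSpace φ₀ (n + 2)) : capMap i φ ∈ normalSpace φ₀ n := by
  induction h using Nat.decreasingInduction generalizing φ with
  | self => exact map_capMap_normalSpace_le (Submodule.mem_map_of_mem hφ)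
  | of_succ i hi ih =>
    rw [← capMap_succ_hookMap hi]
    exact ih (hookMap_mem (isClosed_normalSpace (by omega)) hφ)

theorem apply_mem_span_of_mem_normalSpace {w : List Event} {φ : skeinFunctionals M c n}
    (hw : IsTangle n w 0) (hφ : φ ∈ normalSpace φ₀ n) :
    φ.1 w ∈ Submodule.span R {φ₀.1 [], φ₀.1 [cup 0, cap 0]} := by
  induction w generalizing n with
  | nil =>
    obtain rfl := isTangle_nil_iff.1 hw
    obtain ⟨a, b, rfl⟩ := Submodule.mem_span_pair.1 hφ
    exact Submodule.mem_span_pair.2 ⟨a, b, rfl⟩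
  | cons e w ih =>
    obtain ⟨he, hw⟩ := isTangle_cons_iff.1 hw
    obtain ⟨_ | _ | _, i⟩ := e
    · exact ih (φ := cupMap i φ) hw (cupMap_mem_normalSpace he hφ)
    · obtain ⟨n, rfl⟩ : ∃ k, n = k + 2 := ⟨n - 2, by grind [EventKind.below]⟩
      exact ih (φ := capMap i φ) hw (capMap_mem_normalSpace (Nat.le_of_add_le_add_right he) hφ)
    · obtain ⟨n, rfl⟩ : ∃ k, n = k + 2 := ⟨n - 2, by grind [EventKind.below]⟩
      exact ih (φ := vertexMap i φ) hw (vertexMap_mem (isClosed_normalSpace he) hφ)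

theorem apply_mem_span (φ : skeinFunctionals M c 0) {w : List Event} (hw : IsTangle 0 w 0) :
    φ.1 w ∈ Submodule.span R {φ.1 [], φ.1 [cup 0, cap 0]} :=
  have hφ : φ ∈ normalSpace φ 0 := Submodule.subset_span (Set.mem_insert _ _)
  apply_mem_span_of_mem_normalSpace hw hφ

/-! ### Functions on planar graphs as functionals -/

/-- The functional on words that a function on planar graphs defines, with the value `0` on the
words that do not represent a nonempty graph. -/
def closedValue (P : PlanarGraph → M) (w : List Event) : M :=
  if h : IsTangle 0 w 0 ∧ w ≠ [] then P (.mk ⟨w, h.1, h.2⟩) else 0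

variable {P Q : PlanarGraph → M}

theorem closedValue_of_isTangle {w : List Event} (h : IsTangle 0 w 0) (hw : w ≠ []) :
    closedValue P w = P (.mk ⟨w, h, hw⟩) :=
  dif_pos ⟨h, hw⟩

theorem closedValue_of_not_isTangle {w : List Event} (h : ¬IsTangle 0 w 0) :
    closedValue P w = 0 :=
  dif_neg (mt And.left h)

theorem closedValue_nil : closedValue P [] = 0 :=
  dif_neg fun h => h.2 rfl

theorem Move.left_ne_nil {s t : List Event} (hst : Move s t) : s ≠ [] := by
  cases hst <;> exact List.cons_ne_nil _ _

/-- Straightening a zigzag never yields the empty diagram, since a zigzag needs a further strand. -/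
theorem Move.append_right_ne_nil {p s t : List Event} (hst : Move s t)
    (h : strandsAfter 0 (p ++ s) = strandsAfter 0 (p ++ t)) : p ++ t ≠ [] := by
  intro hnil
  obtain ⟨rfl, rfl⟩ := List.append_eq_nil_iff.1 hnil
  cases hst <;> simp [strandsAfter, cup, cap, EventKind.below, EventKind.above] at h

theorem closedValue_move {p s t u : List Event} (hst : Move s t)
    (h : strandsAfter 0 (p ++ s) = strandsAfter 0 (p ++ t)) :
    closedValue P (p ++ (s ++ u)) = closedValue P (p ++ (t ++ u)) := by
  have hiff : IsTangle 0 (p ++ (s ++ u)) 0 ↔ IsTangle 0 (p ++ (t ++ u)) 0 := by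
    simp only [IsTangle, ← List.append_assoc, strandsAfter_append _ (p ++ _) u, h]
  by_cases hs : IsTangle 0 (p ++ (s ++ u)) 0
  · have hs' : p ++ (s ++ u) ≠ [] := by simp [hst.left_ne_nil]
    have ht' : p ++ (t ++ u) ≠ [] := by
      simpa only [← List.append_assoc] using List.append_ne_nil_of_left_ne_nil
        (hst.append_right_ne_nil h) u
    rw [closedValue_of_isTangle hs hs', closedValue_of_isTangle (hiff.1 hs) ht']
    exact congrArg P (Quot.sound ⟨p, s, t, u, hst, (List.append_assoc ..).symm,
      (List.append_assoc ..).symm⟩)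
  · rw [closedValue_of_not_isTangle hs, closedValue_of_not_isTangle (mt hiff.2 hs)]

theorem SkeinRelations.closedValue_mem_skeinIdentities (hP : SkeinRelations c P) {q : ℕ}
    {p u : List Event} (hp : IsTangle 0 p m) (hq : i + q ≤ m) :
    (fun T : LocalPicture q => closedValue P (p ++ (T.events.map (Event.shift i) ++ u))) ∈
      skeinIdentities M c q := by
  obtain rfl | hq0 := eq_or_ne q 0
  · trivial
  have : NeZero q := ⟨hq0⟩
  obtain ⟨r, rfl⟩ := Nat.exists_eq_add_of_le hq
  have hT (T : LocalPicture q) := hp.append (T.isTangle.shift i r)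
  by_cases hu : IsTangle (i + q + r) u 0
  · convert hP q ⟨i, r, p, u, hp, hu⟩ using 2 with T
    rw [← List.append_assoc]
    exact closedValue_of_isTangle _ _
  · convert zero_mem (skeinIdentities M c q) using 2 with T
    rw [← List.append_assoc]
    exact closedValue_of_not_isTangle (mt (hT T).append_iff.1 hu)

theorem SkeinRelations.isSkeinFunctional (hP : SkeinRelations c P) :
    IsSkeinFunctional c 0 (closedValue P) where
  eq_zero := closedValue_of_not_isTangle
  move := closedValue_move
  identities := hP.closedValue_mem_skeinIdentities

theorem SkeinRelations.mem_span_unknot (hP : SkeinRelations c P) (G : PlanarGraph) :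
    P G ∈ Submodule.span R {P unknot} := by
  induction G using Quot.ind with
  | mk D =>
    have hunknot : closedValue P [cup 0, cap 0] = P unknot := closedValue_of_isTangle _ _
    have hD : closedValue P D.events = P (.mk D) := closedValue_of_isTangle D.closed D.nonempty
    have hmem : closedValue P D.events ∈
        Submodule.span R {closedValue P [], closedValue P [cup 0, cap 0]} :=
      apply_mem_span ⟨closedValue P, hP.isSkeinFunctional⟩ D.closed
    rwa [closedValue_nil, Submodule.span_insert_zero, hunknot, hD] at hmem

end Skein

end PlanarCalculus

theorem theorem3_general {R M : Type*} [CommRing R] [AddCommGroup M] [Module R M]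
    {c : PlanarCalculus.SkeinCoefficients R} {P Q : PlanarCalculus.PlanarGraph → M}
    (hP : PlanarCalculus.SkeinRelations c P) (hQ : PlanarCalculus.SkeinRelations c Q)
    (h : P PlanarCalculus.unknot = Q PlanarCalculus.unknot) : P = Q := by
  funext G
  have hG : (P - Q) G ∈ Submodule.span R {(P - Q) PlanarCalculus.unknot} :=
    (hP.sub hQ).mem_span_unknot G
  rw [Pi.sub_apply, Pi.sub_apply, h, sub_self, Submodule.span_zero_singleton,
    Submodule.mem_bot] at hG
  exact sub_eq_zero.1 hG

/-- A function on planar 4-valent graphs that satisfies the graphical calculus and takes the value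
`1` on the unknot is unique. -/
theorem theorem3 {K : Type*} [Field K] (A B a : K) (hAB : A ≠ B) (ha : a ≠ 0)
    (P Q : PlanarCalculus.PlanarGraph → K)
    (hP : PlanarCalculus.GraphicalCalculus A B a P) (hP_unknot : P PlanarCalculus.unknot = 1)
    (hQ : PlanarCalculus.GraphicalCalculus A B a Q) (hQ_unknot : Q PlanarCalculus.unknot = 1) :
    P = Q :=
  theorem3_general hP.skeinRelations hQ.skeinRelations (hP_unknot.trans hQ_unknot.symm)
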